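/- Identify $\{0,1\}$ with $\mathbb F_2$. Let $\mathrm{Poly}_2(n,d)$ be the set of polynomials in $\mathbb F_2[X_1,\dots,X_n]$ of total degree at most $d$ and individual degrees at most $1$. A *degree-$\ell$ source* on $\{0,1\}^n$ is a distribution of the form $f(\mathbf U_m)$, where $m\ge 0$ is an arbitrary integer, $\mathbf U_m$ is uniform on $\{0,1\}^m$, and every output bit of $f:\{0,1\}^m\to\{0,1\}^n$ is a polynomial over $\mathbb F_2$ of total degree at most $\ell$. The min-entropy of a distribution $\mathbf X$ on $\{0,1\}^n$ is $\mathrm H_\infty(\mathbf X)=\min_{x\in\mathrm{support}(\mathbf X)}-\log_2\Pr[\mathbf X=x]$. A function $D:\{0,1\}^n\to\{0,1\}$ is a *disperser* for a family $\mathcal X$ of sources with min-entropy $k$ if for every $\mathbf X\in\mathcal X$ with $\mathrm H_\infty(\mathbf X)\ge k$ the support of $D(\mathbf X)$ is $\{0,1\}$. **Theorem.** Let $1\le \ell<d\le n$ be integers. There exists $p\in\mathrm{Poly}_2(n,d)$ such that, for every integer $$k\ \ge\ (12^{\ell}\cdot d^{d}\cdot n)^{\frac1{d-\ell}}+1,$$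 $p$ is a disperser for the family of degree-$\ell$ sources on $\{0,1\}^n$ with min-entropy $k$. In particular, for every integer $\ell\ge 0$ there is a constant $C=C(\ell)>0$ such that for every $n\ge 1$ there exists $p\in\mathrm{Poly}_2(n,\ell+2)$ that, for every integer $k\ge C\sqrt n$, is a disperser for the family of degree-$\ell$ sources on $\{0,1\}^n$ with min-entropy $k$. -/

import Mathlib

/-- The cube `{0,1}^n`, identified with `F_2^n`. -/
abbrev Cube (n : ℕ) : Type := Fin n → ZMod 2

/-- `Poly_2(n, d)`: the `n`-variate polynomials over `F_2` of total degree at most `d` and of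
degree at most `1` in each variable. -/
noncomputable def polyF2 (n d : ℕ) : Submodule (ZMod 2) (MvPolynomial (Fin n) (ZMod 2)) :=
  MvPolynomial.restrictTotalDegree (Fin n) (ZMod 2) d ⊓
    MvPolynomial.restrictDegree (Fin n) (ZMod 2) 1

/-- The map `f : {0,1}^m → {0,1}^n` has degree `ℓ`: every output bit is computed by a polynomial
over `F_2` of total degree at most `ℓ`. -/
def IsDegreeMap (ℓ : ℕ) {m n : ℕ} (f : Cube m → Cube n) : Prop :=
  ∀ i : Fin n, ∃ P : MvPolynomial (Fin m) (ZMod 2),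
    P.totalDegree ≤ ℓ ∧ ∀ x : Cube m, f x i = MvPolynomial.eval x P

/-- The family of degree-`ℓ` sources on `{0,1}^n`: the distributions `f(U_m)`, where `m` is
arbitrary, `U_m` is uniform on `{0,1}^m`, and `f : {0,1}^m → {0,1}^n` has degree `ℓ`. -/
def degreeSources (ℓ n : ℕ) : Set (PMF (Cube n)) :=
  {X | ∃ (m : ℕ) (f : Cube m → Cube n),
    IsDegreeMap ℓ f ∧ X = (PMF.uniformOfFintype (Cube m)).map f}

/-- The min-entropy `min_{x ∈ support X} -log₂ Pr[X = x]` of a distribution on a finite type.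
The infimum is over a finite nonempty set, hence it is a minimum. -/
noncomputable def minEntropy {α : Type*} [Finite α] (X : PMF α) : ℝ :=
  ⨅ x : X.support, -Real.logb 2 (X x).toReal

/-- `D : {0,1}^n → {0,1}` is a disperser for the family `𝒳` of sources with min-entropy `k`:
for each `X ∈ 𝒳` of min-entropy at least `k`, the support of `D(X)` is all of `{0,1}`. -/
def IsDisperser {n : ℕ} (D : Cube n → ZMod 2) (𝒳 : Set (PMF (Cube n))) (k : ℝ) : Prop :=
  ∀ X ∈ 𝒳, k ≤ minEntropy X → (X.map D).support = Set.univ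

/-! Probabilistic method, with a uniformly random polynomial of degree at most `d`. Any `2 ^ κ`
points of the cube contain at least `N = lightCount (d + 1) (2 ^ κ)` points on which such
polynomials take arbitrary values (`exists_interpolation`), and `N ≥ κ.choose d`. Hence the random
polynomial is constant on the given points with probability at most `2 / 2 ^ N`
(`card_constant_mul_le`).

A union bound over sources fails directly, because the number `m` of input bits is unbounded. If the
min-entropy is at least `κ + 1`, however, some linear map from `κ + 1` bits into the `m` input bits
leaves more than `2 ^ κ` image points (`exists_combo_image_large`) and does not raise the degree. So
at most `2 ^ (n * (κ + 2) ^ ℓ)` maps matter, and `κ ^ d` beats `n * κ ^ ℓ`, up to constants, once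
`κ` is of order `n ^ (1 / (d - ℓ))`. -/

/-! ### Integers of small binary weight -/

/-- The number of `i < s` with fewer than `e` ones in their binary expansion. -/
def lightCount (e s : ℕ) : ℕ :=
  ∑ i ∈ Finset.range s, if (Nat.digits 2 i).sum < e then 1 else 0

theorem lightCount_succ (e s : ℕ) :
    lightCount e (s + 1) = lightCount e s + if (Nat.digits 2 s).sum < e then 1 else 0 := by
  exact Finset.sum_range_succ _ _

theorem digits_two_sum_double (s : ℕ) : (Nat.digits 2 (2 * s)).sum = (Nat.digits 2 s).sum := by
  rcases Nat.eq_zero_or_pos s with rfl | h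
  · simp
  · rw [Nat.digits_def' (by norm_num) (by omega)]
    simp

theorem digits_two_sum_double_add_one (s : ℕ) :
    (Nat.digits 2 (2 * s + 1)).sum = (Nat.digits 2 s).sum + 1 := by
  rw [Nat.digits_def' (by norm_num) (by omega)]
  have h1 : (2 * s + 1) % 2 = 1 := by omega
  have h2 : (2 * s + 1) / 2 = s := by omega
  rw [h1, h2, List.sum_cons, add_comm]

/-- Sort by the last binary digit: a final 0 keeps the weight, a final 1 adds one. -/
theorem lightCount_double (e s : ℕ) :
    lightCount e (2 * s) = lightCount e s + lightCount (e - 1) s := by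
  induction s with
  | zero => simp [lightCount]
  | succ s ih =>
    rw [show 2 * (s + 1) = 2 * s + 1 + 1 by ring, lightCount_succ, lightCount_succ, ih,
      digits_two_sum_double, digits_two_sum_double_add_one, lightCount_succ, lightCount_succ]
    have : ((Nat.digits 2 s).sum + 1 < e) ↔ ((Nat.digits 2 s).sum < e - 1) := by omega
    simp only [this]
    ring

theorem lightCount_double_add_one (e s : ℕ) :
    lightCount e (2 * s + 1) = lightCount e (s + 1) + lightCount (e - 1) s := by
  rw [lightCount_succ, lightCount_double, digits_two_sum_double, lightCount_succ]
  ring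

/-- Splitting off at most half of the numbers costs one unit of weight. -/
theorem lightCount_add_le (e a b : ℕ) (hab : b ≤ a) :
    lightCount e (a + b) ≤ lightCount e a + lightCount (e - 1) b := by
  induction hN : a + b using Nat.strong_induction_on generalizing e a b with
  | _ N ih =>
  subst hN
  rcases Nat.eq_zero_or_pos b with rfl | hb
  · simp [lightCount]
  obtain ⟨a', ha | ha⟩ := Nat.even_or_odd' a <;> obtain ⟨b', hb' | hb'⟩ := Nat.even_or_odd' b <;>
    subst ha <;> subst hb'
  · rw [← mul_add, lightCount_double, lightCount_double, lightCount_double]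
    have h1 := ih (a' + b') (by omega) e a' b' (by omega) rfl
    have h2 := ih (a' + b') (by omega) (e - 1) a' b' (by omega) rfl
    omega
  · rw [← add_assoc, ← mul_add, lightCount_double, lightCount_double_add_one,
      lightCount_double_add_one]
    have h1 := ih (a' + (b' + 1)) (by omega) e a' (b' + 1) (by omega) rfl
    have h2 := ih (a' + b') (by omega) (e - 1) a' b' (by omega) rfl
    rw [← add_assoc] at h1
    omega
  · rw [show 2 * a' + 1 + 2 * b' = 2 * (a' + b') + 1 by ring, lightCount_double,
      lightCount_double_add_one, lightCount_double_add_one]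
    have h1 := ih (a' + 1 + b') (by omega) e (a' + 1) b' (by omega) rfl
    have h2 := ih (a' + b') (by omega) (e - 1) a' b' (by omega) rfl
    rw [add_right_comm] at h1
    omega
  · rw [show 2 * a' + 1 + (2 * b' + 1) = 2 * (a' + b' + 1) by ring, lightCount_double,
      lightCount_double_add_one, lightCount_double_add_one]
    rcases Nat.lt_or_ge b' a' with h | h
    · have h1 := ih (a' + (b' + 1)) (by omega) e a' (b' + 1) (by omega) rfl
      have h2 := ih (a' + 1 + b') (by omega) (e - 1) (a' + 1) b' (by omega) rfl
      rw [← add_assoc] at h1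
      rw [add_right_comm] at h2
      -- What remains is that `a'` is counted for `e` whenever it is counted for `e - 1`.
      have h3 := lightCount_succ e a'
      have h4 := lightCount_succ (e - 1) a'
      split_ifs at h3 h4 <;> omega
    -- The induction hypothesis has no room here, but both sides agree after halving.
    · obtain rfl : a' = b' := by omega
      rw [← two_mul, lightCount_double_add_one, lightCount_double_add_one]

theorem choose_le_lightCount (κ d : ℕ) : κ.choose d ≤ lightCount (d + 1) (2 ^ κ) := by
  induction κ generalizing d with
  | zero => 
    have h := lightCount_succ 1 0
    cases d <;> simp at h ⊢
    omega
  | succ κ ih =>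
    rw [pow_succ', lightCount_double]
    cases d with
    | zero => have := ih 0; simp at this ⊢; omega
    | succ d =>
      have h1 := ih d
      have h2 := ih (d + 1)
      rw [Nat.choose_succ_succ', Nat.add_sub_cancel]
      omega

/-- The binomial coefficient is a product of ratios `(κ - i) / (d - i)`, each at least `κ / d`. -/
theorem pow_le_choose_mul_pow (κ d : ℕ) (h : d ≤ κ) : κ ^ d ≤ κ.choose d * d ^ d := by
  induction d generalizing κ with
  | zero => simp
  | succ d ih =>
    obtain ⟨κ, rfl⟩ : ∃ c, κ = c + 1 := ⟨κ - 1, by omega⟩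
    have h1 := ih κ (by omega)
    have h2 := Nat.add_one_mul_choose_eq κ d
    rcases Nat.eq_zero_or_pos d with rfl | hd
    · simp
    have h3 : ((κ + 1) * d) ^ d ≤ (κ * (d + 1)) ^ d := Nat.pow_le_pow_left (by nlinarith) d
    rw [mul_pow, mul_pow] at h3
    have h4 : (κ + 1) ^ d * d ^ d ≤ (κ.choose d * (d + 1) ^ d) * d ^ d := by
      calc _ ≤ κ ^ d * (d + 1) ^ d := h3
        _ ≤ (κ.choose d * d ^ d) * (d + 1) ^ d := Nat.mul_le_mul_right _ h1
        _ = _ := by ring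
    have h5 := Nat.le_of_mul_le_mul_right h4 (by positivity)
    calc (κ + 1) ^ (d + 1) = (κ + 1) * (κ + 1) ^ d := by ring
      _ ≤ (κ + 1) * (κ.choose d * (d + 1) ^ d) := Nat.mul_le_mul_left _ h5
      _ = ((κ + 1) * κ.choose d) * (d + 1) ^ d := by ring
      _ = _ := by rw [h2]; ring

/-! ### Low-degree functions on the cube -/

/-- The squarefree monomial with variable set `I`, as a function on the cube. -/
def monoFun {n : ℕ} (I : Finset (Fin n)) : Cube n → ZMod 2 := fun x => ∏ i ∈ I, x i

/-- The functions on the cube computed by polynomials of degree less than `e`. -/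
def lowDeg (n e : ℕ) : Submodule (ZMod 2) (Cube n → ZMod 2) :=
  Submodule.span (ZMod 2) (monoFun '' {I : Finset (Fin n) | I.card < e})

theorem monoFun_mem_lowDeg {n e : ℕ} {I : Finset (Fin n)} (h : I.card < e) :
    monoFun I ∈ lowDeg n e :=
  Submodule.subset_span ⟨I, h, rfl⟩

theorem lowDeg_mono {n e e' : ℕ} (h : e ≤ e') : lowDeg n e ≤ lowDeg n e' :=
  Submodule.span_mono (Set.image_mono fun _ hI => lt_of_lt_of_le hI h)

theorem zmod_two_mul_self (a : ZMod 2) : a * a = a := by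
  revert a; decide

theorem zmod_two_pow (a : ZMod 2) {r : ℕ} (h : r ≠ 0) : a ^ r = a := by
  fin_cases a
  · exact zero_pow h
  · exact one_pow r

theorem coord_mul_mem_lowDeg {n e : ℕ} (i : Fin n) {g : Cube n → ZMod 2} (hg : g ∈ lowDeg n e) :
    (fun x => x i * g x) ∈ lowDeg n (e + 1) := by
  induction hg using Submodule.span_induction with
  | mem g hg =>
    obtain ⟨I, hI, rfl⟩ := hg
    have h : (fun x : Cube n => x i * monoFun I x) = monoFun (insert i I) := by
      funext x
      by_cases hi : i ∈ I
      · rw [Finset.insert_eq_of_mem hi, monoFun, ← Finset.mul_prod_erase I x hi, ← mul_assoc,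
          zmod_two_mul_self]
      · simp [monoFun, Finset.prod_insert hi]
    rw [h]
    have hI' : I.card < e := hI
    exact monoFun_mem_lowDeg ((Finset.card_insert_le i I).trans_lt (by omega))
  | zero =>
    convert (lowDeg n (e + 1)).zero_mem using 1
    funext x
    simp
  | add g₁ g₂ _ _ h₁ h₂ =>
    convert (lowDeg n (e + 1)).add_mem h₁ h₂ using 1
    funext x
    simp [mul_add]
  | smul c g _ h =>
    convert (lowDeg n (e + 1)).smul_mem c h using 1
    funext x
    simp [mul_left_comm]

theorem linear_mul_mem_lowDeg {n e : ℕ} (c : Fin n → ZMod 2) {g : Cube n → ZMod 2}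
    (hg : g ∈ lowDeg n e) : (fun x => (∑ j, x j * c j) * g x) ∈ lowDeg n (e + 1) := by
  have h : (fun x : Cube n => (∑ j, x j * c j) * g x) =
      ∑ j, c j • fun x : Cube n => x j * g x := by
    funext x
    simp only [Finset.sum_mul, Finset.sum_apply, Pi.smul_apply, smul_eq_mul]
    exact Finset.sum_congr rfl fun j _ => by ring
  rw [h]
  exact Submodule.sum_mem _ fun j _ => Submodule.smul_mem _ _ (coord_mul_mem_lowDeg j hg)

/-- The linear map with columns `u j`. -/
def combo {k m : ℕ} (u : Fin k → Cube m) (x : Cube k) : Cube m := fun i => ∑ j, x j * u j i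

theorem comp_combo_mem_lowDeg {k m e : ℕ} (u : Fin k → Cube m) {g : Cube m → ZMod 2}
    (hg : g ∈ lowDeg m e) : (fun x => g (combo u x)) ∈ lowDeg k e := by
  induction hg using Submodule.span_induction with
  | mem g hg =>
    obtain ⟨I, hI, rfl⟩ := hg
    have hI' : I.card + 1 ≤ e := hI
    refine lowDeg_mono hI' ?_
    clear hI hI'
    induction I using Finset.induction_on with
    | empty =>
      have h : (fun x : Cube k => monoFun (∅ : Finset (Fin m)) (combo u x)) =
          monoFun (∅ : Finset (Fin k)) := by funext x; simp [monoFun]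
      rw [h]
      exact monoFun_mem_lowDeg (by simp)
    | insert i I hi ih =>
      rw [Finset.card_insert_of_notMem hi]
      convert linear_mul_mem_lowDeg (fun j => u j i) ih using 1
      funext x
      simp [monoFun, Finset.prod_insert hi, combo]
  | zero => exact (lowDeg k e).zero_mem
  | add g₁ g₂ _ _ h₁ h₂ => exact (lowDeg k e).add_mem h₁ h₂
  | smul c g _ h => exact (lowDeg k e).smul_mem c h

theorem eval_mem_lowDeg {n d : ℕ} (P : MvPolynomial (Fin n) (ZMod 2)) (hP : P.totalDegree ≤ d) :
    (fun x => MvPolynomial.eval x P) ∈ lowDeg n (d + 1) := by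
  have h : (fun x => MvPolynomial.eval x P) =
      ∑ s ∈ P.support, P.coeff s • monoFun s.support := by
    funext x
    simp only [MvPolynomial.eval_eq, Finset.sum_apply, Pi.smul_apply, smul_eq_mul, monoFun]
    refine Finset.sum_congr rfl fun s _ => ?_
    congr 1
    exact Finset.prod_congr rfl fun i hi => zmod_two_pow _ (Finsupp.mem_support_iff.1 hi)
  rw [h]
  refine Submodule.sum_mem _ fun s hs => Submodule.smul_mem _ _ (monoFun_mem_lowDeg ?_)
  have h1 := (MvPolynomial.le_totalDegree hs).trans hP
  have h2 : s.support.card ≤ s.sum fun _ e => e := by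
    rw [Finset.card_eq_sum_ones]
    exact Finset.sum_le_sum fun i hi => Nat.one_le_iff_ne_zero.2 (Finsupp.mem_support_iff.1 hi)
  omega

theorem exists_polyF2_of_mem_lowDeg {n d : ℕ} {g : Cube n → ZMod 2} (hg : g ∈ lowDeg n (d + 1)) :
    ∃ p ∈ polyF2 n d, ∀ x, MvPolynomial.eval x p = g x := by
  induction hg using Submodule.span_induction with
  | mem g hg =>
    obtain ⟨I, hI, rfl⟩ := hg
    have hI' : I.card ≤ d := Nat.lt_succ_iff.1 hI
    refine ⟨MvPolynomial.monomial (∑ i ∈ I, Finsupp.single i 1) 1, ⟨?_, ?_⟩, fun x => ?_⟩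
    · rw [SetLike.mem_coe, MvPolynomial.mem_restrictTotalDegree]
      refine (MvPolynomial.totalDegree_monomial_le _ _).trans ?_
      rw [show ((∑ i ∈ I, Finsupp.single i 1 : Fin n →₀ ℕ).sum fun _ => id) =
        (∑ i ∈ I, Finsupp.single i 1 : Fin n →₀ ℕ).degree from rfl, map_sum]
      simpa using hI'
    · rw [SetLike.mem_coe, MvPolynomial.mem_restrictDegree]
      intro s hs i
      rw [MvPolynomial.support_monomial, if_neg one_ne_zero, Finset.mem_singleton] at hs
      rw [hs, Finsupp.finsetSum_apply]
      simp only [Finsupp.single_apply, Finset.sum_ite_eq']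
      split_ifs <;> simp
    · rw [show (MvPolynomial.monomial (∑ i ∈ I, Finsupp.single i 1) (1 : ZMod 2)) =
        ∏ i ∈ I, MvPolynomial.X i by
          rw [MvPolynomial.monomial_sum_one]; rfl]
      simp [monoFun]
  | zero => exact ⟨0, Submodule.zero_mem _, by simp⟩
  | add g₁ g₂ _ _ h₁ h₂ =>
    obtain ⟨p₁, hp₁, e₁⟩ := h₁
    obtain ⟨p₂, hp₂, e₂⟩ := h₂
    exact ⟨p₁ + p₂, Submodule.add_mem _ hp₁ hp₂, fun x => by simp [e₁, e₂]⟩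
  | smul c g _ h =>
    obtain ⟨p, hp, e⟩ := h
    exact ⟨c • p, Submodule.smul_mem _ _ hp, fun x => by simp [e]⟩

/-- A set of at most `ℓ` elements is built in `ℓ` rounds, each adding one of `m` elements or
nothing. -/
theorem card_filter_card_lt_le (m ℓ : ℕ) :
    (Finset.univ.filter fun I : Finset (Fin m) => I.card < ℓ + 1).card ≤ (m + 1) ^ ℓ := by
  induction ℓ with
  | zero =>
    refine Finset.card_le_one.2 fun I hI J hJ => ?_
    simp at hI hJ
    rw [hI, hJ]
  | succ ℓ ih =>
    have hsub : (Finset.univ.filter fun I : Finset (Fin m) => I.card < ℓ + 1 + 1) ⊆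
        ((Finset.univ : Finset (Option (Fin m))) ×ˢ
          (Finset.univ.filter fun I : Finset (Fin m) => I.card < ℓ + 1)).image
          fun q => q.1.elim q.2 fun i => insert i q.2 := by
      intro I hI
      rw [Finset.mem_filter] at hI
      simp only [Finset.mem_image, Finset.mem_product, Finset.mem_filter, Finset.mem_univ,
        true_and, Prod.exists]
      rcases I.eq_empty_or_nonempty with rfl | ⟨i, hi⟩
      · exact ⟨none, ∅, by simp, rfl⟩
      · refine ⟨some i, I.erase i, ?_, by simp [Finset.insert_erase hi]⟩
        have := Finset.card_erase_lt_of_mem hi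
        omega
    calc _ ≤ _ := Finset.card_le_card hsub
      _ ≤ _ := Finset.card_image_le
      _ ≤ (m + 1) * (m + 1) ^ ℓ := by
        rw [Finset.card_product]
        exact Nat.mul_le_mul (by simp) ih
      _ = _ := by ring

theorem card_lowDeg_le (m ℓ : ℕ) : Nat.card (lowDeg m (ℓ + 1)) ≤ 2 ^ ((m + 1) ^ ℓ) := by
  classical
  set F := Finset.univ.filter fun I : Finset (Fin m) => I.card < ℓ + 1 with hF
  have hspan : lowDeg m (ℓ + 1) = Submodule.span (ZMod 2) (↑(F.image monoFun) : Set _) := by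
    rw [lowDeg, Finset.coe_image]
    congr 2
    ext I
    simp [hF]
  have hrank : Module.finrank (ZMod 2) (lowDeg m (ℓ + 1)) ≤ (m + 1) ^ ℓ := by
    rw [hspan]
    exact (finrank_span_finset_le_card _).trans
      (Finset.card_image_le.trans (card_filter_card_lt_le m ℓ))
  rw [Module.natCard_eq_pow_finrank (K := ZMod 2), Nat.card_zmod]
  exact Nat.pow_le_pow_right (by norm_num) hrank

/-! ### Interpolation on arbitrary point sets -/

/-- Interpolate on `A`, then correct the error on `B` by a multiple of `x i + c`, which vanishes on
`A` and is 1 on `B`. The factor costs one degree, so `B` must do with `e`. -/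
theorem exists_interpolation_of_split {n e : ℕ} {A B : Finset (Cube n)} (i : Fin n) (c : ZMod 2)
    (hA : ∀ x ∈ A, x i = c) (hB : ∀ x ∈ B, x i ≠ c)
    (iA : ∀ g : Cube n → ZMod 2, ∃ p ∈ lowDeg n (e + 1), ∀ x ∈ A, p x = g x)
    (iB : ∀ g : Cube n → ZMod 2, ∃ p ∈ lowDeg n e, ∀ x ∈ B, p x = g x) (g : Cube n → ZMod 2) :
    ∃ p ∈ lowDeg n (e + 1), ∀ x ∈ A ∪ B, p x = g x := by
  obtain ⟨p, hp, hpA⟩ := iA g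
  obtain ⟨r, hr, hrB⟩ := iB fun x => g x - p x
  refine ⟨p + ((fun x => x i * r x) + c • r), Submodule.add_mem _ hp (Submodule.add_mem _
    (coord_mul_mem_lowDeg i hr) (Submodule.smul_mem _ _ (lowDeg_mono (Nat.le_succ e) hr))),
    fun x hx => ?_⟩
  simp only [Pi.add_apply, Pi.smul_apply, smul_eq_mul, ← add_mul]
  rcases Finset.mem_union.1 hx with h | h
  · rw [hA x h, CharTwo.add_self_eq_zero, zero_mul, add_zero, hpA x h]
  · have h1 : ∀ a b : ZMod 2, a ≠ b → a + b = 1 := by decide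
    rw [h1 _ _ (hB x h), one_mul, hrB x h]
    ring

theorem lightCount_zero_left (s : ℕ) : lightCount 0 s = 0 := by simp [lightCount]

theorem lightCount_le (e s : ℕ) : lightCount e s ≤ s := by
  induction s with
  | zero => simp [lightCount]
  | succ s ih => rw [lightCount_succ]; split_ifs <;> omega

/-- Every set of points in the cube contains a large set on which polynomials of degree less
than `e` interpolate arbitrary values. -/
theorem exists_interpolation {n : ℕ} (e : ℕ) (S : Finset (Cube n)) :
    ∃ T ⊆ S, lightCount e S.card ≤ T.card ∧
      ∀ g : Cube n → ZMod 2, ∃ p ∈ lowDeg n e, ∀ x ∈ T, p x = g x := by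
  induction S using Finset.strongInduction generalizing e with
  | H S ih =>
  cases e with
  | zero => exact ⟨∅, by simp, by simp [lightCount_zero_left], fun _ => ⟨0, Submodule.zero_mem _,
      by simp⟩⟩
  | succ e =>
  by_cases hS : S.card ≤ 1
  · refine ⟨S, subset_rfl, lightCount_le _ _, fun g => ?_⟩
    rcases S.eq_empty_or_nonempty with rfl | ⟨y, hy⟩
    · exact ⟨0, Submodule.zero_mem _, by simp⟩
    · refine ⟨g y • monoFun ∅, Submodule.smul_mem _ _ (monoFun_mem_lowDeg (by simp)),
        fun x hx => ?_⟩
      rw [Finset.card_le_one.1 hS x hx y hy]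
      simp [monoFun]
  · obtain ⟨x, hx, y, hy, hxy⟩ := Finset.one_lt_card.1 (not_le.1 hS)
    obtain ⟨i, hi⟩ := Function.ne_iff.1 hxy
    -- Here `c` is the majority value of coordinate `i`; the minority side loses a degree, matching
    -- `lightCount_add_le`.
    have key : ∀ c : ZMod 2, (∃ z ∈ S, z i = c) → (∃ z ∈ S, z i ≠ c) →
        (S.filter fun z => z i ≠ c).card ≤ (S.filter fun z => z i = c).card →
        ∃ T ⊆ S, lightCount (e + 1) S.card ≤ T.card ∧
          ∀ g : Cube n → ZMod 2, ∃ p ∈ lowDeg n (e + 1), ∀ x ∈ T, p x = g x := by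
      rintro c ⟨z, hz, hzc⟩ ⟨w, hw, hwc⟩ hle
      have sA : (S.filter fun z => z i = c) ⊂ S := Finset.filter_ssubset.2 ⟨w, hw, hwc⟩
      have sB : (S.filter fun z => z i ≠ c) ⊂ S :=
        Finset.filter_ssubset.2 ⟨z, hz, not_not.2 hzc⟩
      obtain ⟨A, hA, cA, iA⟩ := ih _ sA (e + 1)
      obtain ⟨B, hB, cB, iB⟩ := ih _ sB e
      have hA' : ∀ x ∈ A, x i = c := fun x hx => (Finset.mem_filter.1 (hA hx)).2
      have hB' : ∀ x ∈ B, x i ≠ c := fun x hx => (Finset.mem_filter.1 (hB hx)).2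
      refine ⟨A ∪ B, Finset.union_subset (hA.trans sA.subset) (hB.trans sB.subset), ?_,
        exists_interpolation_of_split i c hA' hB' iA iB⟩
      rw [Finset.card_union_of_disjoint
        (Finset.disjoint_left.2 fun x hxA hxB => hB' x hxB (hA' x hxA)),
        ← Finset.card_filter_add_card_filter_not (s := S) fun z => z i = c]
      exact (lightCount_add_le (e + 1) _ _ hle).trans (add_le_add cA cB)
    have two : ∀ a b c : ZMod 2, a ≠ b → (c ≠ a ↔ c = b) := by decide
    rcases le_total (S.filter fun z => z i ≠ x i).card (S.filter fun z => z i = x i).card with h | h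
    · exact key (x i) ⟨x, hx, rfl⟩ ⟨y, hy, hi.symm⟩ h
    · refine key (y i) ⟨y, hy, rfl⟩ ⟨x, hx, hi⟩ ?_
      simp only [two _ _ _ hi.symm]
      simpa only [two _ _ _ hi] using h

/-- Few functions of a linear family are constant on a set of points on which the
family interpolates. -/
theorem card_constant_mul_le {n : ℕ} (V : Submodule (ZMod 2) (Cube n → ZMod 2))
    (T : Finset (Cube n)) (hT : ∀ g : Cube n → ZMod 2, ∃ p ∈ V, ∀ x ∈ T, p x = g x) :
    Nat.card {p : V // ∃ c, ∀ x ∈ T, p.1 x = c} * 2 ^ T.card ≤ 2 * Nat.card V := by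
  classical
  choose P hPV hP using hT
  let ext : (T → ZMod 2) → Cube n → ZMod 2 := fun g x => if h : x ∈ T then g ⟨x, h⟩ else 0
  -- Values on `T` minus the recorded constant return `g`, and then `p`, so this map is injective.
  let F : {p : V // ∃ c, ∀ x ∈ T, p.1 x = c} × (T → ZMod 2) → ZMod 2 × V :=
    fun q => (q.1.2.choose, q.1.1 + ⟨P (ext q.2), hPV _⟩)
  have hval : ∀ q, ∀ x : T, (F q).2.1 x = (F q).1 + q.2 x := by
    intro q x
    have h1 : q.1.1.1 x = (F q).1 := q.1.2.choose_spec x x.2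
    have h2 : P (ext q.2) x = q.2 x := by rw [hP _ x x.2]; simp [ext]
    change q.1.1.1 x + P (ext q.2) x = _
    rw [h1, h2]
  have hF : Function.Injective F := by
    intro q r hqr
    have h2 : q.2 = r.2 := by
      funext x
      have hq := hval q x
      rw [hqr, hval r x] at hq
      exact (add_left_cancel hq).symm
    have h1 : q.1 = r.1 := by
      apply Subtype.ext
      have h := congrArg Prod.snd hqr
      simp only [F, h2] at h
      exact add_right_cancel h
    exact Prod.ext h1 h2
  have h := Nat.card_le_card_of_injective F hF
  simpa [Nat.card_prod, Nat.card_fun] using h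

/-! ### Random linear restrictions -/

theorem combo_update_of_zero {k m : ℕ} (u : Fin k → Cube m) (j : Fin k) (t : Cube m) {x : Cube k}
    (hx : x j = 0) : combo (u + Pi.single j t) x = combo u x := by
  funext i
  refine Finset.sum_congr rfl fun l _ => ?_
  rcases eq_or_ne l j with rfl | h
  · rw [hx, zero_mul, zero_mul]
  · simp [h]

theorem combo_update_of_one {k m : ℕ} (u : Fin k → Cube m) (j : Fin k) (t : Cube m) {x : Cube k}
    (hx : x j = 1) : combo (u + Pi.single j t) x = combo u x + t := by
  funext i
  simp only [combo, Pi.add_apply, mul_add, Finset.sum_add_distrib]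
  congr 1
  rw [Finset.sum_eq_single j]
  · simp [hx]
  · intro l _ h
    simp [h]
  · simp

/-- Under a random linear map, two distinct points collide with small probability. -/
theorem card_collision_le {k m : ℕ} {β : Type*} [DecidableEq β] (f : Cube m → β) (K : ℕ)
    (hf : ∀ y, (Finset.univ.filter fun x => f x = y).card * K ≤ 2 ^ m) {x x' : Cube k}
    (hne : x ≠ x') :
    (Finset.univ.filter fun u : Fin k → Cube m => f (combo u x) = f (combo u x')).card * K ≤
      Fintype.card (Fin k → Cube m) := by
  have key : ∀ (j : Fin k) (x x' : Cube k), x j = 0 → x' j = 1 →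
      (Finset.univ.filter fun u : Fin k → Cube m => f (combo u x) = f (combo u x')).card * K ≤
        Fintype.card (Fin k → Cube m) := by
    intro j x x' h0 h1
    -- Adding `t` to column `j` fixes the image of `x` and translates that of `x'` by `t`. Averaging
    -- over `t` makes the latter uniform, so it meets a given fibre with probability at most `1 /
    -- K`.
    have hshift : ∀ t : Cube m,
        (Finset.univ.filter fun u : Fin k → Cube m => f (combo u x) = f (combo u x')).card =
        ∑ u : Fin k → Cube m, if f (combo u x) = f (combo u x' + t) then 1 else 0 := by
      intro t
      rw [Finset.card_filter, ← Equiv.sum_comp (Equiv.addRight (Pi.single j t))]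
      simp only [Equiv.coe_addRight, combo_update_of_zero _ _ _ h0, combo_update_of_one _ _ _ h1]
    have hinner : ∀ u : Fin k → Cube m,
        (∑ t : Cube m, if f (combo u x) = f (combo u x' + t) then 1 else 0) * K ≤ 2 ^ m := by
      intro u
      refine le_trans (le_of_eq ?_) (hf (f (combo u x)))
      congr 1
      rw [Finset.card_filter, ← Equiv.sum_comp (Equiv.addLeft (combo u x'))
        (fun i => if f i = f (combo u x) then 1 else 0)]
      simp only [Equiv.coe_addLeft, eq_comm]
    have hcard : Fintype.card (Cube m) = 2 ^ m := by simp [ZMod.card]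
    refine Nat.le_of_mul_le_mul_left ?_ (Nat.two_pow_pos m)
    calc _ = (∑ _t : Cube m, (Finset.univ.filter fun u : Fin k → Cube m =>
              f (combo u x) = f (combo u x')).card) * K := by
            rw [Finset.sum_const, Finset.card_univ, hcard, smul_eq_mul, mul_assoc]
      _ = ∑ u : Fin k → Cube m,
            (∑ t : Cube m, if f (combo u x) = f (combo u x' + t) then 1 else 0) * K := by
            rw [Finset.sum_congr rfl fun t _ => hshift t, Finset.sum_comm, Finset.sum_mul]
      _ ≤ ∑ _u : Fin k → Cube m, 2 ^ m := Finset.sum_le_sum fun u _ => hinner u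
      _ = _ := by rw [Finset.sum_const, Finset.card_univ, smul_eq_mul, mul_comm]
  obtain ⟨j, hj⟩ := Function.ne_iff.1 hne
  have two : ∀ a b : ZMod 2, a ≠ b → (a = 0 ∧ b = 1) ∨ (b = 0 ∧ a = 1) := by decide
  rcases two _ _ hj with ⟨h0, h1⟩ | ⟨h0, h1⟩
  · exact key j x x' h0 h1
  · simpa only [eq_comm] using key j x' x h0 h1

/-- A function with few collisions has a large image. -/
theorem two_mul_card_le_image {α β : Type*} [Fintype α] [DecidableEq α] [DecidableEq β]
    (g : α → β) :
    2 * Fintype.card α ≤ 2 * (Finset.univ.image g).card +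
      (Finset.univ.filter fun q : α × α => q.1 ≠ q.2 ∧ g q.1 = g q.2).card := by
  have h1 : Fintype.card α =
      ∑ y ∈ Finset.univ.image g, (Finset.univ.filter fun x => g x = y).card := by
    rw [← Finset.card_univ]
    exact Finset.card_eq_sum_card_image g _
  have h2 : (Finset.univ.filter fun q : α × α => q.1 ≠ q.2 ∧ g q.1 = g q.2).card =
      ∑ y ∈ Finset.univ.image g, (Finset.univ.filter fun x => g x = y).offDiag.card := by
    rw [Finset.card_eq_sum_card_fiberwise (f := fun q => g q.1) (t := Finset.univ.image g)
      (fun q _ => by simp)]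
    refine Finset.sum_congr rfl fun y _ => ?_
    congr 1
    ext ⟨a, b⟩
    simp only [Finset.mem_filter, Finset.mem_univ, true_and, Finset.mem_offDiag]
    constructor
    · rintro ⟨⟨h, h'⟩, rfl⟩
      exact ⟨rfl, h'.symm, h⟩
    · rintro ⟨h, h', h''⟩
      exact ⟨⟨h'', h.trans h'.symm⟩, h⟩
  rw [h2, h1, Finset.mul_sum, Finset.card_eq_sum_ones, Finset.mul_sum, ← Finset.sum_add_distrib]
  refine Finset.sum_le_sum fun y _ => ?_
  rw [Finset.offDiag_card]
  generalize (Finset.univ.filter fun x => g x = y).card = s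
  -- This is `(s - 1) * (s - 2) ≥ 0`: a fibre of size `s` satisfies `2 * s ≤ 2 + s * (s - 1)`.
  have h : 3 * s ≤ s * s + 2 := by
    rcases Nat.lt_or_ge s 2 with h | h
    · interval_cases s <;> norm_num
    · obtain ⟨r, rfl⟩ := Nat.exists_eq_add_of_le h
      nlinarith
  omega

/-- Restricting to a suitable `k`-dimensional space of inputs preserves a large image. -/
theorem exists_combo_image_large {k m : ℕ} {β : Type*} [DecidableEq β] (f : Cube m → β)
    (hf : ∀ y, (Finset.univ.filter fun x => f x = y).card * 2 ^ k ≤ 2 ^ m) :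
    ∃ u : Fin k → Cube m,
      2 ^ k < 2 * (Finset.univ.image fun x : Cube k => f (combo u x)).card := by
  by_contra! hcon
  have hk : Fintype.card (Cube k) = 2 ^ k := by simp [ZMod.card]
  set Λ := Fintype.card (Fin k → Cube m) with hΛ
  have hΛ0 : 0 < Λ := Fintype.card_pos
  -- An image of at most half size forces `2 ^ k` ordered collisions for every `u`, while the
  -- average over `u` is at most `2 ^ k - 1`.
  have hcol : ∀ u : Fin k → Cube m, 2 ^ k ≤ (Finset.univ.filter fun q : Cube k × Cube k =>
      q.1 ≠ q.2 ∧ f (combo u q.1) = f (combo u q.2)).card := by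
    intro u
    have h1 := two_mul_card_le_image fun x : Cube k => f (combo u x)
    have h2 := hcon u
    rw [hk] at h1
    omega
  have hswap : ∑ u : Fin k → Cube m, (Finset.univ.filter fun q : Cube k × Cube k =>
      q.1 ≠ q.2 ∧ f (combo u q.1) = f (combo u q.2)).card =
      ∑ q ∈ (Finset.univ : Finset (Cube k)).offDiag, (Finset.univ.filter
        fun u : Fin k → Cube m => f (combo u q.1) = f (combo u q.2)).card := by
    simp only [← Finset.filter_filter, Finset.card_filter]
    rw [Finset.sum_comm' (t' := Finset.univ.offDiag) (s' := fun _ => Finset.univ)]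
    · intro u q
      simp
  have hlow : Λ * 2 ^ k ≤ ∑ q ∈ (Finset.univ : Finset (Cube k)).offDiag, (Finset.univ.filter
        fun u : Fin k → Cube m => f (combo u q.1) = f (combo u q.2)).card := by
    rw [← hswap, hΛ, ← Finset.card_univ, ← smul_eq_mul, ← Finset.sum_const]
    exact Finset.sum_le_sum fun u _ => hcol u
  have hup : (∑ q ∈ (Finset.univ : Finset (Cube k)).offDiag, (Finset.univ.filter
        fun u : Fin k → Cube m => f (combo u q.1) = f (combo u q.2)).card) * 2 ^ k ≤
        (2 ^ k * 2 ^ k - 2 ^ k) * Λ := by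
    rw [Finset.sum_mul]
    refine (Finset.sum_le_sum fun q hq =>
      card_collision_le f (2 ^ k) hf (Finset.mem_offDiag.1 hq).2.2).trans ?_
    rw [Finset.sum_const, Finset.offDiag_card, Finset.card_univ, hk, smul_eq_mul]
  have h := (Nat.mul_le_mul_right (2 ^ k) hlow).trans hup
  have hp : 0 < 2 ^ k := by positivity
  have hlt : 2 ^ k * 2 ^ k - 2 ^ k < 2 ^ k * 2 ^ k := Nat.sub_lt (by positivity) hp
  have := Nat.mul_lt_mul_of_pos_right hlt hΛ0
  rw [mul_assoc, mul_comm Λ] at h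
  omega

/-! ### From min-entropy to maps on `k` bits -/

theorem card_fibre_of_le_minEntropy {m n k : ℕ} (f : Cube m → Cube n)
    (hk : (k : ℝ) ≤ minEntropy ((PMF.uniformOfFintype (Cube m)).map f)) (y : Cube n) :
    (Finset.univ.filter fun x => f x = y).card * 2 ^ k ≤ 2 ^ m := by
  classical
  set X := (PMF.uniformOfFintype (Cube m)).map f with hX
  have hXy : (X y).toReal = (Finset.univ.filter fun x => f x = y).card / 2 ^ m := by
    rw [hX, PMF.map_apply, tsum_fintype, ENNReal.toReal_sum]
    · simp only [PMF.uniformOfFintype_apply, apply_ite ENNReal.toReal, ENNReal.toReal_zero]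
      rw [← Finset.sum_filter, Finset.sum_const]
      simp [eq_comm, ZMod.card, div_eq_mul_inv]
    · intro a _
      split_ifs
      · exact PMF.apply_ne_top _ _
      · exact ENNReal.zero_ne_top
  rcases Nat.eq_zero_or_pos (Finset.univ.filter fun x => f x = y).card with h0 | h0
  · simp [h0]
  have hpos : 0 < (X y).toReal := by rw [hXy]; positivity
  have hy : y ∈ X.support := by
    rw [PMF.mem_support_iff]
    intro h
    simp [h] at hpos
  have h1 : (k : ℝ) ≤ -Real.logb 2 (X y).toReal :=
    hk.trans (ciInf_le (Set.finite_range _).bddBelow (⟨y, hy⟩ : X.support))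
  have h2 : (X y).toReal ≤ (2 : ℝ) ^ (-(k : ℝ)) :=
    (Real.logb_le_iff_le_rpow (by norm_num) hpos).1 (by linarith)
  rw [hXy, Real.rpow_neg (by norm_num), Real.rpow_natCast, div_le_iff₀ (by positivity),
    inv_mul_eq_div, le_div_iff₀ (by positivity)] at h2
  exact_mod_cast h2

/-- Removes the unbounded `m`: nonconstancy need only be checked on maps of `k` bits with a large
image. -/
theorem disperses_of_not_constant {n ℓ : ℕ} {D : Cube n → ZMod 2} {k : ℕ}
    (hD : ∀ f : Cube k → Cube n, (∀ i, (fun x => f x i) ∈ lowDeg k (ℓ + 1)) →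
      2 ^ k < 2 * (Finset.univ.image f).card → ¬ ∃ c, ∀ x, D (f x) = c) :
    IsDisperser D (degreeSources ℓ n) (k : ℝ) := by
  rintro X ⟨m, f, hf, rfl⟩ hk
  obtain ⟨u, hu⟩ := exists_combo_image_large f (card_fibre_of_le_minEntropy f hk)
  have hnc := hD (fun x => f (combo u x)) (fun i => by
    obtain ⟨P, hP, hfP⟩ := hf i
    simp only [hfP]
    exact comp_combo_mem_lowDeg u (eval_mem_lowDeg P hP)) hu
  rw [PMF.map_comp, PMF.support_map, PMF.support_uniformOfFintype, Set.top_eq_univ,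
    Set.image_univ, Set.range_eq_univ]
  intro b
  by_contra! hb
  have two : ∀ a b : ZMod 2, a ≠ b → a = b + 1 := by decide
  exact hnc ⟨b + 1, fun x => two _ _ (hb _)⟩

/-! ### The union bound and its parameters -/

/-- A counting argument: few low-degree maps against the few functions constant on a large image. -/
theorem exists_lowDeg_not_constant {n ℓ e κ : ℕ}
    (h : n * (κ + 2) ^ ℓ + 1 < lightCount e (2 ^ κ)) :
    ∃ p ∈ lowDeg n e, ∀ f : Cube (κ + 1) → Cube n,
      (∀ i, (fun x => f x i) ∈ lowDeg (κ + 1) (ℓ + 1)) →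
      2 ^ (κ + 1) < 2 * (Finset.univ.image f).card → ¬ ∃ c, ∀ x, p (f x) = c := by
  classical
  by_contra! hcon
  let G := {f : Cube (κ + 1) → Cube n // (∀ i, (fun x => f x i) ∈ lowDeg (κ + 1) (ℓ + 1)) ∧
      2 ^ (κ + 1) < 2 * (Finset.univ.image f).card}
  set N := lightCount e (2 ^ κ) with hN
  have hG : Nat.card G ≤ 2 ^ (n * (κ + 2) ^ ℓ) := by
    let F : G → (Fin n → lowDeg (κ + 1) (ℓ + 1)) := fun f i => ⟨fun x => f.1 x i, f.2.1 i⟩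
    have hF : Function.Injective F := by
      intro f g hfg
      apply Subtype.ext
      funext x i
      exact congrFun (congrArg Subtype.val (congrFun hfg i)) x
    calc Nat.card G ≤ Nat.card (Fin n → lowDeg (κ + 1) (ℓ + 1)) :=
          Nat.card_le_card_of_injective F hF
      _ = Nat.card (lowDeg (κ + 1) (ℓ + 1)) ^ n := by rw [Nat.card_fun, Nat.card_fin]
      _ ≤ (2 ^ ((κ + 2) ^ ℓ)) ^ n := Nat.pow_le_pow_left (card_lowDeg_le _ _) n
      _ = _ := by rw [← pow_mul, mul_comm]
  have hbad : ∀ f : G,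
      Nat.card {p : lowDeg n e // ∃ c, ∀ x, p.1 (f.1 x) = c} * 2 ^ N ≤
        2 * Nat.card (lowDeg n e) := by
    rintro ⟨f, hf, himg⟩
    obtain ⟨S, hS, hSc⟩ := Finset.exists_subset_card_eq
      (show 2 ^ κ ≤ (Finset.univ.image f).card by rw [pow_succ] at himg; omega)
    obtain ⟨T, hTS, hT, iT⟩ := exists_interpolation e S
    rw [hSc] at hT
    refine le_trans (Nat.mul_le_mul ?_ (Nat.pow_le_pow_right (by norm_num) hT))
      (card_constant_mul_le (lowDeg n e) T iT)
    refine Nat.card_le_card_of_injective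
      (Subtype.map id fun p ⟨c, hc⟩ => ⟨c, fun y hy => ?_⟩)
      (Subtype.map_injective _ Function.injective_id)
    obtain ⟨x, -, rfl⟩ := Finset.mem_image.1 (hS (hTS hy))
    exact hc x
  -- If every `p` fails, the bad sets of the maps in `G` cover `lowDeg n e`.
  choose f h1 h2 c hc using hcon
  let F : lowDeg n e → (Σ f : G, {p : lowDeg n e // ∃ c, ∀ x, p.1 (f.1 x) = c}) :=
    fun p => ⟨⟨f p.1 p.2, h1 p.1 p.2, h2 p.1 p.2⟩, p, c p.1 p.2, hc p.1 p.2⟩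
  have hF : Function.Injective F := by
    intro p q hpq
    exact congrArg (fun s => s.2.1) hpq
  have hcard := Nat.card_le_card_of_injective F hF
  rw [Nat.card_sigma] at hcard
  have h3 : Nat.card (lowDeg n e) * 2 ^ N ≤ 2 ^ (n * (κ + 2) ^ ℓ) * (2 * Nat.card (lowDeg n e)) := by
    calc _ ≤ _ := Nat.mul_le_mul_right (2 ^ N) hcard
      _ ≤ ∑ _f : G, 2 * Nat.card (lowDeg n e) := by
        rw [Finset.sum_mul]
        exact Finset.sum_le_sum fun f _ => hbad f
      _ = Nat.card G * (2 * Nat.card (lowDeg n e)) := by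
        rw [Finset.sum_const, Finset.card_univ, ← Nat.card_eq_fintype_card (α := G), smul_eq_mul]
      _ ≤ _ := Nat.mul_le_mul_right _ hG
  -- The `+ 1` pays for the two possible constant values.
  have h4 : 2 ^ N ≤ 2 ^ (n * (κ + 2) ^ ℓ + 1) := by
    refine Nat.le_of_mul_le_mul_left ?_ (Nat.card_pos (α := lowDeg n e))
    rw [pow_succ]
    linarith
  have h5 := (Nat.pow_le_pow_iff_right (by norm_num)).1 h4
  omega

/-- The constant is `12 = 3 * 4`: `κ + 2 ≤ 3 * κ` uses the 3, and `4 ^ ℓ ≥ 4` absorbs the `+ 1`. The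
hypothesis itself forces `d ≤ κ`. -/
theorem counting_bound {n ℓ d κ : ℕ} (hℓd : ℓ < d) (hℓ : 1 ≤ ℓ) (hn : 1 ≤ n)
    (h : 12 ^ ℓ * d ^ d * n ≤ κ ^ (d - ℓ)) :
    n * (κ + 2) ^ ℓ + 1 < lightCount (d + 1) (2 ^ κ) := by
  have hd : 1 ≤ d := by omega
  have hdd : 0 < d ^ d := by positivity
  have hκ : 0 < κ := by
    rcases Nat.eq_zero_or_pos κ with rfl | h0
    · rw [zero_pow (by omega)] at h
      have : 0 < 12 ^ ℓ * d ^ d * n := by positivity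
      omega
    · exact h0
  have h1 : κ ^ ℓ * (12 ^ ℓ * d ^ d * n) ≤ κ ^ d := by
    calc _ ≤ κ ^ ℓ * κ ^ (d - ℓ) := Nat.mul_le_mul_left _ h
      _ = _ := by rw [← pow_add]; congr 1; omega
  have hκℓ : 0 < κ ^ ℓ := by positivity
  have hdκ : d ≤ κ := by
    refine (Nat.pow_le_pow_iff_left (n := d) (by omega)).1 (le_trans ?_ h1)
    calc d ^ d = 1 * (1 * d ^ d * 1) := by ring
      _ ≤ _ := by gcongr; exacts [hκℓ, Nat.one_le_pow _ _ (by norm_num)]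
  have h2 := (h1.trans (pow_le_choose_mul_pow κ d hdκ)).trans
    (Nat.mul_le_mul_right _ (choose_le_lightCount κ d))
  have h3 : κ ^ ℓ * 12 ^ ℓ * n ≤ lightCount (d + 1) (2 ^ κ) := by
    refine Nat.le_of_mul_le_mul_right (le_trans (le_of_eq ?_) h2) hdd
    ring
  have h4 : (κ + 2) ^ ℓ ≤ κ ^ ℓ * 3 ^ ℓ := by
    rw [← mul_pow]
    exact Nat.pow_le_pow_left (by omega) ℓ
  have h5 : 3 ^ ℓ * 4 ≤ 12 ^ ℓ := by
    rw [show 12 = 3 * 4 by norm_num, mul_pow]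
    exact Nat.mul_le_mul_left _ (Nat.le_self_pow (by omega) 4)
  have h6 : n * (κ + 2) ^ ℓ * 4 ≤ κ ^ ℓ * 12 ^ ℓ * n := by
    calc _ ≤ n * (κ ^ ℓ * 3 ^ ℓ) * 4 := by gcongr
      _ = κ ^ ℓ * (3 ^ ℓ * 4) * n := by ring
      _ ≤ _ := by gcongr
  have h7 : 1 ≤ n * (κ + 2) ^ ℓ := Nat.mul_pos hn (by positivity)
  omega

theorem exists_disperser (ℓ d n : ℕ) (hℓ : 1 ≤ ℓ) (hℓd : ℓ < d) (hdn : d ≤ n) :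
    ∃ p ∈ polyF2 n d, ∀ k : ℕ,
      ((12 : ℝ) ^ ℓ * (d : ℝ) ^ d * (n : ℝ)) ^ ((1 : ℝ) / ((d : ℝ) - (ℓ : ℝ))) + 1 ≤ (k : ℝ) →
        IsDisperser (fun x => MvPolynomial.eval x p) (degreeSources ℓ n) (k : ℝ) := by
  set A : ℝ := (12 : ℝ) ^ ℓ * (d : ℝ) ^ d * (n : ℝ) with hA
  set κ := ⌈A ^ ((1 : ℝ) / ((d : ℝ) - (ℓ : ℝ)))⌉₊ with hκ
  have hA0 : 0 ≤ A := by positivity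
  have hbound : 12 ^ ℓ * d ^ d * n ≤ κ ^ (d - ℓ) := by
    have h : A ≤ (κ : ℝ) ^ (d - ℓ) := by
      have h1 := pow_le_pow_left₀ (Real.rpow_nonneg hA0 _)
        (Nat.le_ceil (A ^ ((1 : ℝ) / ((d : ℝ) - (ℓ : ℝ))))) (d - ℓ)
      rwa [← Nat.cast_sub hℓd.le, one_div, Real.rpow_inv_natCast_pow hA0 (by omega),
        Nat.cast_sub hℓd.le, ← one_div] at h1
    rw [hA] at h
    exact_mod_cast h
  obtain ⟨g, hg, hgD⟩ := exists_lowDeg_not_constant (n := n)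
    (counting_bound hℓd hℓ (by omega) hbound)
  obtain ⟨p, hp, hpg⟩ := exists_polyF2_of_mem_lowDeg hg
  refine ⟨p, hp, fun k hk X hX hXk => ?_⟩
  -- One `p`, built for `κ + 1`, serves every admissible `k`, since `κ + 1 ≤ k`.
  refine disperses_of_not_constant (k := κ + 1) (fun f hf hfi => ?_) X hX (le_trans ?_ hXk)
  · simpa only [hpg] using hgD f hf hfi
  · have h1 : κ ≤ k - 1 := Nat.ceil_le.2 (by
      have : 1 ≤ k := by
        have := Real.rpow_nonneg hA0 ((1 : ℝ) / ((d : ℝ) - (ℓ : ℝ)))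
        exact_mod_cast (show (1 : ℝ) ≤ k by linarith)
      rw [Nat.cast_sub this]
      push_cast
      linarith)
    have h2 : 1 ≤ k := by
      have := Real.rpow_nonneg hA0 ((1 : ℝ) / ((d : ℝ) - (ℓ : ℝ)))
      exact_mod_cast (show (1 : ℝ) ≤ k by linarith)
    exact_mod_cast (show κ + 1 ≤ k by omega)

/-! ### The square-root bound -/

/-- A source whose support has few points has small min-entropy. -/
theorem two_pow_le_card_image {m n k : ℕ} (f : Cube m → Cube n)
    (hk : (k : ℝ) ≤ minEntropy ((PMF.uniformOfFintype (Cube m)).map f)) :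
    2 ^ k ≤ (Finset.univ.image f).card := by
  classical
  have h := Finset.card_eq_sum_card_image f Finset.univ
  have h1 : Fintype.card (Cube m) = 2 ^ m := by simp [ZMod.card]
  rw [Finset.card_univ, h1] at h
  refine Nat.le_of_mul_le_mul_left ?_ (Nat.two_pow_pos m)
  calc 2 ^ m * 2 ^ k = ∑ y ∈ Finset.univ.image f,
        (Finset.univ.filter fun x => f x = y).card * 2 ^ k := by rw [← Finset.sum_mul, ← h]
    _ ≤ ∑ _y ∈ Finset.univ.image f, 2 ^ m :=
        Finset.sum_le_sum fun y _ => card_fibre_of_le_minEntropy f hk y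
    _ = _ := by rw [Finset.sum_const, smul_eq_mul, mul_comm]

theorem isDisperser_of_lt {n ℓ k : ℕ} (D : Cube n → ZMod 2) (h : n < k) :
    IsDisperser D (degreeSources ℓ n) (k : ℝ) := by
  rintro X ⟨m, f, -, rfl⟩ hk
  have h1 := (two_pow_le_card_image f hk).trans (Finset.card_le_univ _)
  have h2 : Fintype.card (Cube n) = 2 ^ n := by simp [ZMod.card]
  rw [h2] at h1
  exact absurd ((Nat.pow_le_pow_iff_right (by norm_num)).1 h1) (not_le.2 h)

theorem isDisperser_degree_zero {n k : ℕ} (D : Cube n → ZMod 2) (h : 0 < k) :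
    IsDisperser D (degreeSources 0 n) (k : ℝ) := by
  rintro X ⟨m, f, hf, rfl⟩ hk
  have h1 := two_pow_le_card_image f hk
  have h2 : (Finset.univ.image f).card ≤ 1 := by
    refine Finset.card_le_one.2 fun a ha b hb => ?_
    obtain ⟨x, -, rfl⟩ := Finset.mem_image.1 ha
    obtain ⟨y, -, rfl⟩ := Finset.mem_image.1 hb
    funext i
    obtain ⟨P, hP, hfP⟩ := hf i
    rw [MvPolynomial.totalDegree_eq_zero_iff_eq_C.1 (Nat.le_zero.1 hP)] at hfP
    simp [hfP]
  exact absurd (h1.trans h2) (not_le.2 (Nat.one_lt_two_pow h.ne'))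

theorem exists_disperser_sqrt (ℓ : ℕ) : ∃ C : ℝ, 0 < C ∧ ∀ n : ℕ, 1 ≤ n →
    ∃ p ∈ polyF2 n (ℓ + 2), ∀ k : ℕ, C * Real.sqrt (n : ℝ) ≤ (k : ℝ) →
      IsDisperser (fun x => MvPolynomial.eval x p) (degreeSources ℓ n) (k : ℝ) := by
  set B : ℝ := (12 : ℝ) ^ ℓ * ((ℓ + 2 : ℕ) : ℝ) ^ (ℓ + 2) with hB
  -- For `d = ℓ + 2` the root is `√B * √n`. The extra `ℓ + 2` absorbs the `+ 1` and gives `k > n`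
  -- when `n < ℓ + 2`.
  refine ⟨Real.sqrt B + (ℓ + 2), by positivity, fun n hn => ?_⟩
  have hs : (1 : ℝ) ≤ Real.sqrt n := Real.one_le_sqrt.2 (by exact_mod_cast hn)
  have hBs := Real.sqrt_nonneg B
  have hℓ0 : (0 : ℝ) ≤ ℓ := Nat.cast_nonneg ℓ
  -- If `ℓ = 0` or `n < ℓ + 2`, no source has enough min-entropy, so the zero polynomial works
  -- vacuously.
  rcases Nat.eq_zero_or_pos ℓ with h0 | h0
  · refine ⟨0, Submodule.zero_mem _, fun k hk => ?_⟩
    have hk0 : 0 < k := by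
      have : (0 : ℝ) < (Real.sqrt B + (ℓ + 2)) * Real.sqrt n := by positivity
      exact_mod_cast this.trans_le hk
    rw [h0]
    exact isDisperser_degree_zero _ hk0
  rcases Nat.lt_or_ge n (ℓ + 2) with hn2 | hn2
  · refine ⟨0, Submodule.zero_mem _, fun k hk => isDisperser_of_lt _ (hn2.trans_le ?_)⟩
    have : ((ℓ + 2 : ℕ) : ℝ) ≤ k := by
      push_cast
      nlinarith
    exact_mod_cast this
  · obtain ⟨p, hp, hD⟩ := exists_disperser ℓ (ℓ + 2) n h0 (by omega) hn2
    refine ⟨p, hp, fun k hk => hD k (le_trans ?_ hk)⟩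
    have h1 : (1 : ℝ) / (((ℓ + 2 : ℕ) : ℝ) - ℓ) = 1 / 2 := by push_cast; ring
    rw [h1, ← Real.sqrt_eq_rpow, ← hB, Real.sqrt_mul (by positivity)]
    nlinarith

theorem mainTheorem10 :
    (∀ ℓ d n : ℕ, 1 ≤ ℓ → ℓ < d → d ≤ n →
      ∃ p ∈ polyF2 n d, ∀ k : ℕ,
        ((12 : ℝ) ^ ℓ * (d : ℝ) ^ d * (n : ℝ)) ^ ((1 : ℝ) / ((d : ℝ) - (ℓ : ℝ))) + 1 ≤ (k : ℝ) →
          IsDisperser (fun x => MvPolynomial.eval x p) (degreeSources ℓ n) (k : ℝ)) ∧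
    (∀ ℓ : ℕ, ∃ C : ℝ, 0 < C ∧ ∀ n : ℕ, 1 ≤ n →
      ∃ p ∈ polyF2 n (ℓ + 2), ∀ k : ℕ, C * Real.sqrt (n : ℝ) ≤ (k : ℝ) →
        IsDisperser (fun x => MvPolynomial.eval x p) (degreeSources ℓ n) (k : ℝ)) :=
  ⟨exists_disperser, exists_disperser_sqrt⟩
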